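/- For $\rho>1$ let $\mathcal E_\rho\subset\mathbb C$ be the closed Bernstein ellipse $\{z: (\Re z/a_\rho)^2+(\Im z/b_\rho)^2\le 1\}$, $a_\rho=\frac{\rho+\rho^{-1}}2$, $b_\rho=\frac{\rho-\rho^{-1}}2$, and let $\mathcal E'_\rho=\frac12(\mathcal E_\rho+1)$. For integers $m\ge 0$, $N\ge1$ let $c_N^\alpha=\frac{\cos(\pi\alpha/N)+1}{2}$, $\alpha=0,\dots,N$, be the Chebyshev--Lobatto nodes on $[0,1]$, let $P_N^\alpha$ be their Lagrange cardinal polynomials, and for $f:[0,1]\to\mathbb R$ put $$E_{m,N}[f]=\max_{u\in[0,1-2^{-m}],\,v\in[0,1]}\Bigl|f(u+2^{-m}v)-\sum_{\alpha=0}^N f(u+2^{-m}c_N^\alpha)P_N^\alpha(v)\Bigr|.$$ The quantized tensor representation of $f$ of depth $K$ is the tensor $T(\sigma_1,\dots,\sigma_K)=f\bigl(\sum_{k=1}^K2^{-k}\sigma_k\bigr)$, $\sigma\in\{0,1\}^K$. For $m<K$ and $\varepsilon>0$, the $(\varepsilon,\infty)$-rank $r_m^{(\varepsilon,\infty)}[T]$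 of its $m$-th unfolding matrix is the smallest $r$ for which there are real tensors $L^\alpha$ on $\{0,1\}^m$ and $R^\alpha$ on $\{0,1\}^{K-m}$, $0\le\alpha<r$, with $\max_\sigma\bigl|T(\sigma)-\sum_{\alpha<r}L^\alpha(\sigma_1,\dots,\sigma_m)R^\alpha(\sigma_{m+1},\dots,\sigma_K)\bigr|\le\varepsilon$. Let $\rho>1$ and $B\ge0$, and for $m\ge0$ put $\rho_m=\max\bigl(\rho,\,2^m(\rho-1)^2/\rho\bigr)$. Suppose that $f:[0,1]\to\mathbb R$ extends analytically to $\mathcal E'_\rho$ (that is, to a neighbourhood of it) and that the extension is bounded by $B$ in absolute value on $\mathcal E'_\rho$. (i) For all $m\ge0$ and $N\ge1$, the maximum defining $E_{m,N}[f]$ exists and $$E_{m,N}[f]\le\frac{4B\rho_m^{-N}}{\rho_m-1}.$$ (ii) If $T$ is the quantized tensor representation of $f$ of depth $K>m\ge0$, then for every $\varepsilon>0$ $$r_m^{(\varepsilon,\infty)}[T]\le1+\max\Bigl\{1,\bigl\lceil\log_{\rho_m}(1/\varepsilon)-\log_{\rho_m}(\rho_m-1)+\log_{\rho_m}(4B)\bigr\rceil\Bigr\},$$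 where for $B=0$ the logarithm of $4B$ is read as $-\infty$, so that the right-hand side is $2$. (iii) The ranks are roughly bounded by $1+\lceil m^{-1}\log_2(1/\varepsilon)\rceil$ for large $m$, in the following sense: for every $\delta>0$ there is an $M$, depending only on $\rho$, $B$ and $\delta$, such that for all $m\ge M$, all $f$ as above, all $K>m$ and all $0<\varepsilon<1$, the tensor $T$ of $f$ of depth $K$ satisfies $$r_m^{(\varepsilon,\infty)}[T]\le1+\bigl\lceil(1+\delta)\,m^{-1}\log_2(1/\varepsilon)\bigr\rceil.$$ -/

import Mathlib

noncomputable section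

namespace QTT

/-- Semi-major axis `a_ρ = (ρ + ρ⁻¹) / 2`. -/
def semiMajor (ρ : ℝ) : ℝ := (ρ + ρ⁻¹) / 2

/-- Semi-minor axis `b_ρ = (ρ - ρ⁻¹) / 2`. -/
def semiMinor (ρ : ℝ) : ℝ := (ρ - ρ⁻¹) / 2

/-- The (closed, filled) Bernstein ellipse with foci `±1`. -/
def bernsteinEllipse (ρ : ℝ) : Set ℂ :=
  {z | (z.re / semiMajor ρ) ^ 2 + (z.im / semiMinor ρ) ^ 2 ≤ 1}

/-- The Bernstein ellipse shifted and scaled to have foci `0` and `1`: `(E_ρ + 1) / 2`. -/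
def shiftedEllipse (ρ : ℝ) : Set ℂ :=
  (fun z : ℂ => (z + 1) / 2) '' bernsteinEllipse ρ

/-- The restriction of `f` to `[0,1]` extends to a complex function which is analytic on (a
neighbourhood of) the shifted Bernstein ellipse and is bounded by `B` there.
A function on `[0,1]` is represented by `f : ℝ → ℝ`, of which only the values on `[0,1]` are
ever used. -/
def HasBoundedAnalyticExtension (ρ B : ℝ) (f : ℝ → ℝ) : Prop :=
  ∃ F : ℂ → ℂ, AnalyticOnNhd ℂ F (shiftedEllipse ρ) ∧
    (∀ x ∈ Set.Icc (0 : ℝ) 1, F (x : ℂ) = (f x : ℂ)) ∧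
    ∀ z ∈ shiftedEllipse ρ, ‖F z‖ ≤ B

/-- The Chebyshev-Lobatto grid `c_N^α`, `α = 0, …, N`, on `[0,1]`. -/
def chebNode (N : ℕ) (α : Fin (N + 1)) : ℝ :=
  (Real.cos (Real.pi * (α : ℕ) / N) + 1) / 2

/-- The Lagrange cardinal polynomials `P_N^α` of the Chebyshev-Lobatto grid. -/
def chebCardinal (N : ℕ) (α : Fin (N + 1)) : Polynomial ℝ :=
  Lagrange.basis Finset.univ (chebNode N) α

/-- The error at the point `u + 2⁻ᵐ v` of Chebyshev-Lobatto interpolation of `f` on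
`[u, u + 2⁻ᵐ]`. -/
def pointwiseError (m N : ℕ) (f : ℝ → ℝ) (u v : ℝ) : ℝ :=
  |f (u + v / 2 ^ m) -
    ∑ α : Fin (N + 1), f (u + chebNode N α / 2 ^ m) * (chebCardinal N α).eval v|

/-- All the pointwise errors, over `u ∈ [0, 1 - 2⁻ᵐ]` and `v ∈ [0,1]`. -/
def errorValues (m N : ℕ) (f : ℝ → ℝ) : Set ℝ :=
  {e | ∃ u ∈ Set.Icc (0 : ℝ) (1 - 1 / 2 ^ m), ∃ v ∈ Set.Icc (0 : ℝ) 1,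
    e = pointwiseError m N f u v}

/-- The interpolation error `E_{m,N}[f]`, the largest pointwise error. -/
def interpError (m N : ℕ) (f : ℝ → ℝ) : ℝ := sSup (errorValues m N f)

/-- Tensors with `K` binary indices. The norm `‖S‖` of such a tensor is, in Mathlib,
the largest absolute value of an entry, that is, the tensor `∞`-norm. -/
abbrev BinTensor (K : ℕ) : Type := (Fin K → Fin 2) → ℝ

/-- The dyadic point `0.σ₁σ₂…σ_K`; the bit `σ_{k+1}` is `σ k`. -/
def dyadicPoint {K : ℕ} (σ : Fin K → Fin 2) : ℝ :=
  ∑ k : Fin K, ((σ k : ℕ) : ℝ) / 2 ^ ((k : ℕ) + 1)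

/-- The quantized tensor representation of `f` on the dyadic grid of depth `K`. -/
def quantizedTensor (K : ℕ) (f : ℝ → ℝ) : BinTensor K := fun σ => f (dyadicPoint σ)

/-- The leading bits `σ_{1:m}`. -/
def leftBits {K m : ℕ} (hm : m ≤ K) (σ : Fin K → Fin 2) : Fin m → Fin 2 :=
  fun i => σ (Fin.castLE hm i)

/-- The trailing bits `σ_{m+1:K}`. -/
def rightBits {K m : ℕ} (hm : m ≤ K) (σ : Fin K → Fin 2) : Fin (K - m) → Fin 2 :=
  fun j => σ ⟨m + j, by have := j.isLt; omega⟩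

/-- The tensor `∑_{α < r} L^α ⊗ R^α`, whose `m`-th unfolding matrix has rank at most `r`. -/
def tensorOfFactors {K m r : ℕ} (hm : m ≤ K) (L : Fin r → BinTensor m)
    (R : Fin r → BinTensor (K - m)) : BinTensor K :=
  fun σ => ∑ α : Fin r, L α (leftBits hm σ) * R α (rightBits hm σ)

/-- The `m`-th unfolding of `T` is within `ε`, in the tensor `∞`-norm, of `r` terms. -/
def ApproxByRank {K m : ℕ} (hm : m ≤ K) (ε : ℝ) (T : BinTensor K) (r : ℕ) : Prop :=
  ∃ (L : Fin r → BinTensor m) (R : Fin r → BinTensor (K - m)),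
    ‖T - tensorOfFactors hm L R‖ ≤ ε

/-- The `(ε,∞)` rank of the `m`-th unfolding matrix of `T`: the smallest `r` as above. -/
def supRank {K m : ℕ} (hm : m ≤ K) (ε : ℝ) (T : BinTensor K) : ℕ :=
  sInf {r | ApproxByRank hm ε T r}

/-- The minimum in the definition of the `(ε,∞)` rank is over a nonempty set. -/
theorem exists_approxByRank {K m : ℕ} (hm : m ≤ K) {ε : ℝ} (hε : 0 ≤ ε) (T : BinTensor K) :
    ∃ r, ApproxByRank hm ε T r := by
  classical
  let e := Fintype.equivFin (Fin m → Fin 2)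
  refine ⟨Fintype.card (Fin m → Fin 2), fun α τ => if e τ = α then 1 else 0,
    fun α ω => T fun k => if h : (k : ℕ) < m then e.symm α ⟨k, h⟩
      else ω ⟨k - m, by have := k.isLt; omega⟩, ?_⟩
  refine le_of_eq_of_le ?_ hε
  rw [norm_eq_zero, sub_eq_zero]
  funext σ
  simp only [tensorOfFactors, ite_mul, one_mul, zero_mul, Finset.sum_ite_eq, Finset.mem_univ,
    if_true, Equiv.symm_apply_apply]
  congr 1
  funext k
  by_cases h : (k : ℕ) < m
  · simp [h, leftBits, Fin.castLE]
  · have hk : m + ((k : ℕ) - m) = k := by omega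
    simp [h, rightBits, hk]

/-- `ρ_m = max(ρ, 2ᵐ (ρ - 1)² / ρ)`. -/
def levelRho (ρ : ℝ) (m : ℕ) : ℝ := max ρ (2 ^ m * ((ρ - 1) ^ 2 / ρ))

end QTT

end

/-!
By the two-focus description, a point lies in the shifted Bernstein ellipse of parameter `ρ` when the
sum of its distances to `0` and `1` is at most `a_ρ`, and `2 (a_ρ - 1) = (ρ - 1) ^ 2 / ρ`. For
`v` in the ellipse of parameter `R`, the triangle inequality bounds the focal sum at `u + 2⁻ᵐ v` by
`1 + 2⁻ᵐ (a_R - 1)`, so that ellipse is mapped into the one of parameter `ρ` as soon as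
`(R - 1) ^ 2 / R ≤ 2 ^ m (ρ - 1) ^ 2 / ρ`. This holds for `R = levelRho ρ m`, since
`(R - 1) ^ 2 / R ≤ R` (`HasBoundedAnalyticExtension.rescale`). It therefore suffices to treat
interpolation on `[0, 1]` itself.

There, the Joukowski map pulls the analytic extension back to an annulus. Its Fourier coefficients on
the unit circle are bounded by `B ρ ^ (-|n|)`, by moving the contour to either boundary circle
(`norm_laurentCoeff_le_natAbs`), and the resulting Fourier series is a Chebyshev series
`∑ c n T n` over `ℤ` (`exists_hasSum_chebyshev`). On the Chebyshev–Lobatto grid with `N + 1` nodes each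
`T n` agrees with some `T j`, `|j| ≤ N` (`exists_chebyshev_alias`), so its interpolation error is `0`
for `|n| ≤ N` and at most `2` otherwise. Summing the two geometric tails gives
`4 B ρ ^ (-N) / (ρ - 1)` (`abs_signedError_le`).

The rank bounds follow because the interpolant of `f` at `u + 2⁻ᵐ v` is a sum of `N + 1` products of a
function of `u`, which is given by the leading bits, and one of `v`, given by the trailing bits
(`supRank_le_of_pointwiseError_le`). It remains to solve the error bound for `N`; for the uniform
decay of the ranks one uses that `levelRho ρ m` eventually exceeds `2 ^ (m / (1 + δ))`.
-/

/-! ### Bernstein ellipses as sets of bounded focal sum -/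

namespace QTT

open Complex Metric

/-- The two-focus description of the Bernstein ellipse. -/
theorem mem_bernsteinEllipse_iff {ρ : ℝ} (hρ : 1 < ρ) (z : ℂ) :
    z ∈ bernsteinEllipse ρ ↔ ‖z - 1‖ + ‖z + 1‖ ≤ 2 * semiMajor ρ := by
  have hρ0 : 0 < ρ := by linarith
  have hi : ρ * ρ⁻¹ = 1 := mul_inv_cancel₀ hρ0.ne'
  have hi1 : ρ⁻¹ < 1 := inv_lt_one_of_one_lt₀ hρ
  have hab : semiMinor ρ ^ 2 = semiMajor ρ ^ 2 - 1 := by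
    unfold semiMajor semiMinor; linear_combination -hi
  have hb : 0 < semiMinor ρ := by unfold semiMinor; linarith
  have ha : 1 < semiMajor ρ := by
    have h0 : 0 < semiMajor ρ := by unfold semiMajor; positivity
    nlinarith [pow_pos hb 2]
  set a := semiMajor ρ
  set b := semiMinor ρ
  obtain ⟨x, y⟩ := z
  have hp : ‖(⟨x, y⟩ : ℂ) - 1‖ ^ 2 = (x - 1) ^ 2 + y ^ 2 := by
    rw [← normSq_eq_norm_sq, normSq_apply]; simp; ring
  have hq : ‖(⟨x, y⟩ : ℂ) + 1‖ ^ 2 = (x + 1) ^ 2 + y ^ 2 := by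
    rw [← normSq_eq_norm_sq, normSq_apply]; simp; ring
  have hp0 := norm_nonneg ((⟨x, y⟩ : ℂ) - 1)
  have hq0 := norm_nonneg ((⟨x, y⟩ : ℂ) + 1)
  have hsum : 2 ≤ ‖(⟨x, y⟩ : ℂ) - 1‖ + ‖(⟨x, y⟩ : ℂ) + 1‖ := by
    have := norm_sub_le ((⟨x, y⟩ : ℂ) + 1) (⟨x, y⟩ - 1)
    have h2 : ((⟨x, y⟩ : ℂ) + 1) - (⟨x, y⟩ - 1) = 2 := by ring
    rw [h2] at this
    simp only [Complex.norm_ofNat] at this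
    linarith
  set p := ‖(⟨x, y⟩ : ℂ) - 1‖
  set q := ‖(⟨x, y⟩ : ℂ) + 1‖
  -- clearing denominators in the equation of the ellipse
  have key : (x / a) ^ 2 + (y / b) ^ 2 ≤ 1 ↔
      0 ≤ (a ^ 2) ^ 2 - a ^ 2 * (1 + x ^ 2 + y ^ 2) + x ^ 2 := by
    rw [div_pow, div_pow, div_add_div _ _ (by positivity) (by positivity),
      div_le_one (by positivity), hab]
    constructor <;> intro h <;> nlinarith
  change (x / a) ^ 2 + (y / b) ^ 2 ≤ 1 ↔ _
  rw [key]
  -- the quadratic `t ^ 2 - t (1 + x ^ 2 + y ^ 2) + x ^ 2` has the roots `A ^ 2` and `d ^ 2`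
  obtain ⟨A, hA⟩ : ∃ A, A = (p + q) / 2 := ⟨_, rfl⟩
  obtain ⟨d, hd⟩ : ∃ d, d = (q - p) / 2 := ⟨_, rfl⟩
  have hAd : A * d = x := by rw [hA, hd]; linear_combination (hq - hp) / 4
  have hAd2 : A ^ 2 + d ^ 2 = 1 + x ^ 2 + y ^ 2 := by
    rw [hA, hd]; linear_combination (hq + hp) / 2
  have hA1 : 1 ≤ A := by linarith
  -- the product `(A ^ 2 - 1) (1 - d ^ 2) = y ^ 2` is nonnegative, which settles the case `1 < A`
  have hd1 : d ^ 2 ≤ 1 := by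
    have hprod : 0 ≤ (A ^ 2 - 1) * (1 - d ^ 2) := by
      nlinarith [sq_nonneg y]
    rcases hA1.eq_or_lt with h | h
    · have : q - p ≤ 2 := by linarith
      have : p - q ≤ 2 := by linarith
      rw [hd]; nlinarith
    · have : 0 < A ^ 2 - 1 := by nlinarith
      nlinarith [nonneg_of_mul_nonneg_right hprod this]
  have hfac : (a ^ 2) ^ 2 - a ^ 2 * (1 + x ^ 2 + y ^ 2) + x ^ 2
      = (a ^ 2 - A ^ 2) * (a ^ 2 - d ^ 2) := by
    rw [← hAd2, ← hAd]; ring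
  rw [hfac]
  have hpos : 0 < a ^ 2 - d ^ 2 := by nlinarith
  rw [mul_nonneg_iff_of_pos_right hpos, sub_nonneg, sq_le_sq₀ (by linarith) (by linarith)]
  constructor <;> intro h <;> linarith

theorem mem_shiftedEllipse_iff {ρ : ℝ} (hρ : 1 < ρ) (w : ℂ) :
    w ∈ shiftedEllipse ρ ↔ ‖w‖ + ‖w - 1‖ ≤ semiMajor ρ := by
  have h1 : w ∈ shiftedEllipse ρ ↔ 2 * w - 1 ∈ bernsteinEllipse ρ := by
    constructor
    · rintro ⟨z, hz, rfl⟩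
      convert hz using 1
      ring
    · intro h
      exact ⟨_, h, by ring⟩
  have e1 : ‖2 * w - 1 - 1‖ = 2 * ‖w - 1‖ := by
    rw [show 2 * w - 1 - 1 = 2 * (w - 1) by ring, norm_mul, Complex.norm_ofNat]
  have e2 : ‖2 * w - 1 + 1‖ = 2 * ‖w‖ := by
    rw [sub_add_cancel, norm_mul, Complex.norm_ofNat]
  rw [h1, mem_bernsteinEllipse_iff hρ, e1, e2]
  constructor <;> intro h <;> linarith

/-- The quantity `(ρ - 1) ^ 2 / ρ` in `levelRho` is the excess of the major axis over the focal
distance. -/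
theorem two_mul_semiMajor_sub_one {ρ : ℝ} (hρ : 1 < ρ) :
    2 * (semiMajor ρ - 1) = (ρ - 1) ^ 2 / ρ := by
  have : ρ ≠ 0 := by linarith
  unfold semiMajor
  field_simp
  ring

theorem one_le_semiMajor {ρ : ℝ} (hρ : 1 < ρ) : 1 ≤ semiMajor ρ := by
  have := two_mul_semiMajor_sub_one hρ
  have : 0 ≤ (ρ - 1) ^ 2 / ρ := by positivity
  linarith

theorem one_lt_levelRho {ρ : ℝ} (hρ : 1 < ρ) (m : ℕ) : 1 < levelRho ρ m :=
  lt_max_of_lt_left hρ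

/-- Rescaling by `2 ^ m` shrinks the excess of the semi-major axis over the half focal distance
enough for the ellipse of parameter `levelRho ρ m` to fit into the one of parameter `ρ`. -/
theorem semiMajor_levelRho_sub_one_le {ρ : ℝ} (hρ : 1 < ρ) (m : ℕ) :
    semiMajor (levelRho ρ m) - 1 ≤ 2 ^ m * (semiMajor ρ - 1) := by
  have h1 := two_mul_semiMajor_sub_one hρ
  have h2 := two_mul_semiMajor_sub_one (one_lt_levelRho hρ m)
  have h3 := one_lt_levelRho hρ m
  rcases max_choice ρ (2 ^ m * ((ρ - 1) ^ 2 / ρ)) with h | h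
  · have h4 : levelRho ρ m = ρ := h
    rw [h4]
    nlinarith [one_le_pow₀ (M₀ := ℝ) one_le_two (n := m), one_le_semiMajor hρ]
  · -- with `R = levelRho ρ m = 2 ^ m * (2 * (semiMajor ρ - 1))`, the excess `(R - 1) ^ 2 / R`
    -- is at most `R`
    have h4 : levelRho ρ m = 2 ^ m * ((ρ - 1) ^ 2 / ρ) := h
    rw [← h1] at h4
    have h5 : (levelRho ρ m - 1) ^ 2 / levelRho ρ m ≤ levelRho ρ m := by
      rw [div_le_iff₀ (by linarith)]
      nlinarith
    linarith

theorem ofReal_mem_shiftedEllipse {ρ : ℝ} (hρ : 1 < ρ) {x : ℝ} (hx : x ∈ Set.Icc (0 : ℝ) 1) :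
    (x : ℂ) ∈ shiftedEllipse ρ := by
  rw [mem_shiftedEllipse_iff hρ, ← ofReal_one, ← ofReal_sub, norm_real, norm_real,
    Real.norm_of_nonneg hx.1, Real.norm_of_nonpos (by linarith [hx.2])]
  linarith [one_le_semiMajor hρ]

/-- The restriction of `f` to a dyadic-length interval `[u, u + 2⁻ᵐ]`, rescaled to `[0, 1]`,
extends to the larger ellipse of parameter `levelRho ρ m`, with the same bound. -/
theorem HasBoundedAnalyticExtension.rescale {ρ B : ℝ} (hρ : 1 < ρ) {f : ℝ → ℝ}
    (hf : HasBoundedAnalyticExtension ρ B f) (m : ℕ) {u : ℝ}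
    (hu : u ∈ Set.Icc (0 : ℝ) (1 - 1 / 2 ^ m)) :
    HasBoundedAnalyticExtension (levelRho ρ m) B (fun v => f (u + v / 2 ^ m)) := by
  obtain ⟨F, hF, hfF, hB⟩ := hf
  have h2 : (0 : ℝ) < 2 ^ m := by positivity
  have hmap : ∀ w ∈ shiftedEllipse (levelRho ρ m), (u : ℂ) + w / 2 ^ m ∈ shiftedEllipse ρ := by
    intro w hw
    rw [mem_shiftedEllipse_iff (one_lt_levelRho hρ m)] at hw
    rw [mem_shiftedEllipse_iff hρ]
    have n1 : ‖(u : ℂ) + w / 2 ^ m‖ ≤ u + ‖w‖ / 2 ^ m := by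
      refine (norm_add_le _ _).trans_eq ?_
      rw [norm_real, Real.norm_of_nonneg hu.1, norm_div, norm_pow, Complex.norm_ofNat]
    have n2 : ‖(u : ℂ) + w / 2 ^ m - 1‖ ≤ (1 - 1 / 2 ^ m - u) + ‖w - 1‖ / 2 ^ m := by
      have e : (u : ℂ) + w / 2 ^ m - 1
          = -((1 - 1 / 2 ^ m - u : ℝ) : ℂ) + (w - 1) / 2 ^ m := by
        push_cast; ring
      rw [e]
      refine (norm_add_le _ _).trans_eq ?_
      rw [norm_neg, norm_real, Real.norm_of_nonneg (by linarith [hu.2]), norm_div, norm_pow,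
        Complex.norm_ofNat]
    have h3 : (‖w‖ + ‖w - 1‖ - 1) / 2 ^ m ≤ semiMajor ρ - 1 := by
      rw [div_le_iff₀ h2]
      linarith [semiMajor_levelRho_sub_one_le hρ m]
    have h4 : (‖w‖ + ‖w - 1‖ - 1) / 2 ^ m = ‖w‖ / 2 ^ m + ‖w - 1‖ / 2 ^ m - 1 / 2 ^ m := by
      ring
    linarith
  refine ⟨fun w => F ((u : ℂ) + w / 2 ^ m), fun w hw => ?_, fun x hx => ?_,
    fun w hw => hB _ (hmap w hw)⟩
  · exact (hF _ (hmap w hw)).fun_comp (f := fun w : ℂ => (u : ℂ) + w / 2 ^ m) (by fun_prop)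
  · have hx1 : x / 2 ^ m ≤ 1 / 2 ^ m := by gcongr; exact hx.2
    have hx0 : 0 ≤ x / 2 ^ m := div_nonneg hx.1 h2.le
    have := hfF (u + x / 2 ^ m) ⟨by linarith [hu.1], by linarith [hu.2]⟩
    push_cast at this
    exact this

/-- The Joukowski map `z ↦ (z + z⁻¹) / 2`, followed by the shift to foci `0` and `1`, sends the
annulus `ρ⁻¹ ≤ ‖z‖ ≤ ρ` into the ellipse. -/
theorem joukowski_mem_shiftedEllipse {ρ : ℝ} (hρ : 1 < ρ) {z : ℂ} (h1 : ρ⁻¹ ≤ ‖z‖)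
    (h2 : ‖z‖ ≤ ρ) : ((z + z⁻¹) / 2 + 1) / 2 ∈ shiftedEllipse ρ := by
  have hρ0 : 0 < ρ := by linarith
  have hz : 0 < ‖z‖ := lt_of_lt_of_le (inv_pos.2 hρ0) h1
  have hz0 : z ≠ 0 := norm_pos_iff.1 hz
  rw [mem_shiftedEllipse_iff hρ]
  have e1 : ((z + z⁻¹) / 2 + 1) / 2 = (z + 1) ^ 2 / (4 * z) := by field_simp; ring
  have e2 : ((z + z⁻¹) / 2 + 1) / 2 - 1 = (z - 1) ^ 2 / (4 * z) := by field_simp; ring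
  rw [e2, e1, norm_div, norm_div, norm_pow, norm_pow, norm_mul, Complex.norm_ofNat, ← add_div,
    ← normSq_eq_norm_sq, ← normSq_eq_norm_sq]
  have e3 : normSq (z + 1) + normSq (z - 1) = 2 * (‖z‖ ^ 2 + 1) := by
    rw [← normSq_eq_norm_sq, normSq_apply, normSq_apply, normSq_apply]
    simp
    ring
  rw [e3, div_le_iff₀ (by positivity)]
  have h3 : 1 ≤ ‖z‖ * ρ := by
    have := mul_le_mul_of_nonneg_right h1 hρ0.le
    rwa [inv_mul_cancel₀ hρ0.ne'] at this
  have h4 : ‖z‖ ^ 2 + 1 ≤ (ρ + ρ⁻¹) * ‖z‖ := by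
    have e : (ρ + ρ⁻¹) * ‖z‖ - (‖z‖ ^ 2 + 1) = (ρ - ‖z‖) * (‖z‖ * ρ - 1) / ρ := by
      field_simp; ring
    have : 0 ≤ (ρ - ‖z‖) * (‖z‖ * ρ - 1) / ρ :=
      div_nonneg (mul_nonneg (by linarith) (by linarith)) hρ0.le
    linarith
  unfold semiMajor
  linarith

end QTT

/-! ### Laurent coefficients on an annulus and the Chebyshev series -/

namespace QTT

open Complex Metric

/-- The `n`-th Laurent coefficient of `G`, as an integral over the unit circle. -/
noncomputable def laurentCoeff (G : ℂ → ℂ) (n : ℤ) : ℂ :=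
  (2 * Real.pi * I)⁻¹ * ∮ z in C(0, 1), (z - 0)⁻¹ • (z ^ (-n) * G z)

/-- Cauchy's estimate: the circle of integration may be moved to any radius in the annulus. -/
theorem norm_laurentCoeff_le {G : ℂ → ℂ} {ρ B R : ℝ} (hρ : 1 < ρ)
    (hG : ∀ z, ρ⁻¹ ≤ ‖z‖ → ‖z‖ ≤ ρ → DifferentiableAt ℂ G z)
    (hB : ∀ z, ρ⁻¹ ≤ ‖z‖ → ‖z‖ ≤ ρ → ‖G z‖ ≤ B) (hR1 : ρ⁻¹ ≤ R) (hR2 : R ≤ ρ) (n : ℤ) :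
    ‖laurentCoeff G n‖ ≤ B * R ^ (-n) := by
  have hρ0 : 0 < ρ⁻¹ := inv_pos.2 (by linarith)
  have hρi : ρ⁻¹ ≤ 1 := inv_le_one_of_one_le₀ hρ.le
  have hR : 0 < R := hρ0.trans_le hR1
  have hd : ∀ z, ρ⁻¹ ≤ ‖z‖ → ‖z‖ ≤ ρ → DifferentiableAt ℂ (fun z => z ^ (-n) * G z) z := by
    intro z h1 h2
    exact (differentiableAt_zpow.2 (Or.inl (norm_pos_iff.1 (hρ0.trans_le h1)))).mul (hG z h1 h2)
  have shift : ∀ r s : ℝ, ρ⁻¹ ≤ r → r ≤ s → s ≤ ρ →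
      (∮ z in C(0, s), (z - 0)⁻¹ • (z ^ (-n) * G z)) =
        ∮ z in C(0, r), (z - 0)⁻¹ • (z ^ (-n) * G z) := by
    intro r s h1 h2 h3
    refine circleIntegral_sub_center_inv_smul_eq_of_differentiable_on_annulus_off_countable
      (hρ0.trans_le h1) h2 Set.countable_empty (fun z hz => ?_) (fun z hz => ?_)
    · rw [Set.mem_sdiff, mem_closedBall_zero_iff, mem_ball_zero_iff, not_lt] at hz
      exact (hd z (h1.trans hz.2) (hz.1.trans h3)).continuousAt.continuousWithinAt
    · rw [Set.sdiff_empty, Set.mem_sdiff, mem_closedBall_zero_iff, mem_ball_zero_iff, not_le] at hz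
      exact hd z (h1.trans hz.2.le) (hz.1.le.trans h3)
  have hRint : laurentCoeff G n =
      (2 * Real.pi * I)⁻¹ * ∮ z in C(0, R), (z - 0)⁻¹ • (z ^ (-n) * G z) := by
    unfold laurentCoeff
    rcases le_total 1 R with h | h
    · rw [shift 1 R hρi h hR2]
    · rw [shift R 1 hR1 h hρ.le]
  have hbound : ‖∮ z in C(0, R), (z - 0)⁻¹ • (z ^ (-n) * G z)‖ ≤
      2 * Real.pi * R * (R⁻¹ * (R ^ (-n) * B)) := by
    refine circleIntegral.norm_integral_le_of_norm_le_const hR.le fun z hz => ?_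
    rw [mem_sphere_zero_iff_norm] at hz
    rw [sub_zero, norm_smul, norm_mul, norm_inv, norm_zpow, hz]
    gcongr
    exact hB z (hz ▸ hR1) (hz ▸ hR2)
  rw [hRint, norm_mul, norm_inv, norm_mul, norm_mul, Complex.norm_I, Complex.norm_ofNat, norm_real,
    Real.norm_of_nonneg Real.pi_pos.le, mul_one, inv_mul_le_iff₀ Real.two_pi_pos]
  refine hbound.trans_eq ?_
  field_simp

theorem norm_laurentCoeff_le_natAbs {G : ℂ → ℂ} {ρ B : ℝ} (hρ : 1 < ρ)
    (hG : ∀ z, ρ⁻¹ ≤ ‖z‖ → ‖z‖ ≤ ρ → DifferentiableAt ℂ G z)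
    (hB : ∀ z, ρ⁻¹ ≤ ‖z‖ → ‖z‖ ≤ ρ → ‖G z‖ ≤ B) (n : ℤ) :
    ‖laurentCoeff G n‖ ≤ B * ρ⁻¹ ^ n.natAbs := by
  have hρi : ρ⁻¹ ≤ ρ := (inv_le_one_of_one_le₀ hρ.le).trans hρ.le
  rcases le_total 0 n with h | h
  · refine (norm_laurentCoeff_le hρ hG hB hρi le_rfl n).trans_eq ?_
    rw [← zpow_natCast, Int.natCast_natAbs, abs_of_nonneg h, inv_zpow, zpow_neg]
  · refine (norm_laurentCoeff_le hρ hG hB le_rfl hρi n).trans_eq ?_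
    rw [← zpow_natCast, Int.natCast_natAbs, abs_of_nonpos h]

theorem summable_pow_natAbs {r : ℝ} (h0 : 0 ≤ r) (h1 : r < 1) :
    Summable fun n : ℤ => r ^ n.natAbs :=
  Summable.of_nat_of_neg (by simpa using summable_geometric_of_lt_one h0 h1)
    (by simpa using summable_geometric_of_lt_one h0 h1)

/-- On the unit circle the Laurent series is a Fourier series, which converges because its
coefficients decay geometrically. -/
theorem hasSum_laurent {G : ℂ → ℂ} {ρ B : ℝ} (hρ : 1 < ρ)
    (hG : ∀ z, ρ⁻¹ ≤ ‖z‖ → ‖z‖ ≤ ρ → DifferentiableAt ℂ G z)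
    (hB : ∀ z, ρ⁻¹ ≤ ‖z‖ → ‖z‖ ≤ ρ → ‖G z‖ ≤ B) (θ : ℝ) :
    HasSum (fun n : ℤ => laurentCoeff G n * exp (n * θ * I)) (G (exp (θ * I))) := by
  have : Fact (0 < 2 * Real.pi) := ⟨Real.two_pi_pos⟩
  have hρi : ρ⁻¹ < 1 := inv_lt_one_of_one_lt₀ hρ
  have hcirc : ∀ x : AddCircle (2 * Real.pi), ‖(AddCircle.toCircle x : ℂ)‖ = 1 := fun x =>
    Circle.norm_coe _
  let h : C(AddCircle (2 * Real.pi), ℂ) :=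
    ⟨fun x => G (AddCircle.toCircle x), by
      rw [continuous_iff_continuousAt]
      intro x
      refine ContinuousAt.comp (f := fun x => (AddCircle.toCircle x : ℂ)) (g := G)
        (hG _ ?_ ?_).continuousAt ?_
      · rw [hcirc]; exact hρi.le
      · rw [hcirc]; exact hρ.le
      · exact (continuous_subtype_val.comp AddCircle.continuous_toCircle).continuousAt⟩
  have hto : ∀ x : ℝ, (AddCircle.toCircle (x : AddCircle (2 * Real.pi)) : ℂ) = exp (x * I) := by
    intro x
    rw [AddCircle.toCircle_apply_mk, div_self Real.two_pi_pos.ne', one_mul, Circle.coe_exp]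
  have hfou : ∀ (n : ℤ) (x : ℝ),
      fourier n (x : AddCircle (2 * Real.pi)) = exp (n * x * I) := by
    intro n x
    rw [fourier_coe_apply]
    congr 1
    have : (Real.pi : ℂ) ≠ 0 := ofReal_ne_zero.2 Real.pi_ne_zero
    push_cast
    field_simp
  have hcoeff : ∀ n, fourierCoeff h n = laurentCoeff G n := by
    intro n
    have hI : (∮ z in C(0, 1), (z - 0)⁻¹ • (z ^ (-n) * G z)) =
        I * ∫ x in (0 : ℝ)..2 * Real.pi, fourier (-n) (x : AddCircle (2 * Real.pi)) • h x := by
      rw [circleIntegral, ← intervalIntegral.integral_const_mul]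
      refine intervalIntegral.integral_congr fun x _ => ?_
      have hm : circleMap 0 1 x = exp (x * I) := by simp [circleMap]
      have hh : h x = G (exp (x * I)) := by
        change G (AddCircle.toCircle (x : AddCircle (2 * Real.pi))) = _
        rw [hto]
      have hz : exp (x * I) ^ (-n) = exp ((-n : ℤ) * x * I) := by
        rw [← exp_int_mul, mul_assoc]
      simp only [deriv_circleMap, hm, hh, hfou, hz, smul_eq_mul, sub_zero]
      field_simp
    rw [fourierCoeff_eq_intervalIntegral _ _ 0, zero_add, laurentCoeff, hI]
    have : (Real.pi : ℂ) ≠ 0 := ofReal_ne_zero.2 Real.pi_ne_zero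
    rw [Complex.real_smul]
    push_cast
    field_simp
  have hsum : Summable (fourierCoeff h) := by
    refine Summable.of_norm_bounded
      ((summable_pow_natAbs (inv_nonneg.2 (by linarith)) hρi).mul_left B) fun n => ?_
    rw [hcoeff]
    exact norm_laurentCoeff_le_natAbs hρ hG hB n
  have := has_pointwise_sum_fourier_series_of_summable hsum (θ : AddCircle (2 * Real.pi))
  simp only [hcoeff, hfou, smul_eq_mul] at this
  convert this using 1
  change _ = G (AddCircle.toCircle (θ : AddCircle (2 * Real.pi)))
  rw [hto]

/-- The Chebyshev series of a function analytic on a Bernstein ellipse, written as a sum over `ℤ`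
with `T (-k) = T k`. The coefficients are the Laurent coefficients of the Joukowski pullback. -/
theorem exists_hasSum_chebyshev {ρ B : ℝ} (hρ : 1 < ρ) {g : ℝ → ℝ}
    (hg : HasBoundedAnalyticExtension ρ B g) :
    ∃ c : ℤ → ℝ, (∀ n, |c n| ≤ B * ρ⁻¹ ^ n.natAbs) ∧ ∀ v ∈ Set.Icc (0 : ℝ) 1,
      HasSum (fun n => c n * (Polynomial.Chebyshev.T ℝ n).eval (2 * v - 1)) (g v) := by
  obtain ⟨F, hF, hgF, hB⟩ := hg
  have hρ0 : 0 < ρ⁻¹ := inv_pos.2 (by linarith)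
  let G : ℂ → ℂ := fun z => F (((z + z⁻¹) / 2 + 1) / 2)
  have hG : ∀ z, ρ⁻¹ ≤ ‖z‖ → ‖z‖ ≤ ρ → DifferentiableAt ℂ G z := by
    intro z h1 h2
    have hz : z ≠ 0 := norm_pos_iff.1 (hρ0.trans_le h1)
    refine DifferentiableAt.comp (g := F) (f := fun z : ℂ => ((z + z⁻¹) / 2 + 1) / 2) z
      (hF _ (joukowski_mem_shiftedEllipse hρ h1 h2)).differentiableAt ?_
    fun_prop (disch := exact hz)
  have hGB : ∀ z, ρ⁻¹ ≤ ‖z‖ → ‖z‖ ≤ ρ → ‖G z‖ ≤ B := fun z h1 h2 =>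
    hB _ (joukowski_mem_shiftedEllipse hρ h1 h2)
  refine ⟨fun n => (laurentCoeff G n).re, fun n =>
    (abs_re_le_norm _).trans (norm_laurentCoeff_le_natAbs hρ hG hGB n), fun v hv => ?_⟩
  set θ := Real.arccos (2 * v - 1)
  have hθ : Real.cos θ = 2 * v - 1 := Real.cos_arccos (by linarith [hv.1]) (by linarith [hv.2])
  have hval : ∀ t : ℝ, Real.cos t = 2 * v - 1 → G (exp (t * I)) = (g v : ℂ) := by
    intro t ht
    have e : ((exp (t * I) + (exp (t * I))⁻¹) / 2 + 1) / 2 = (v : ℂ) := by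
      rw [← exp_neg, ← neg_mul, ← Complex.cos, ← ofReal_cos, ht]
      push_cast
      ring
    change F _ = _
    rw [e, hgF v hv]
  -- averaging over `±θ` turns the exponentials into cosines
  have h1 := hasSum_laurent hρ hG hGB θ
  have h2 := hasSum_laurent hρ hG hGB (-θ)
  rw [hval θ hθ] at h1
  rw [hval (-θ) (by rw [Real.cos_neg, hθ])] at h2
  have h3 := hasSum_re ((h1.add h2).mul_left (1 / 2))
  have hlim : ((1 / 2 : ℂ) * ((g v : ℂ) + g v)).re = g v := by
    rw [show (1 / 2 : ℂ) * ((g v : ℂ) + g v) = g v by ring, ofReal_re]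
  rw [hlim] at h3
  convert h3 using 2 with n
  have hc : (1 / 2 : ℂ) * (laurentCoeff G n * exp (n * θ * I) +
      laurentCoeff G n * exp (n * (-θ : ℝ) * I)) =
      laurentCoeff G n * ((Real.cos (n * θ) : ℝ) : ℂ) := by
    rw [ofReal_cos, Complex.cos]
    push_cast
    rw [show (n : ℂ) * -θ * I = -(n * θ) * I by ring]
    ring
  rw [hc, re_mul_ofReal, ← hθ, Polynomial.Chebyshev.T_real_cos]

end QTT

/-! ### Interpolation at the Chebyshev–Lobatto nodes -/

namespace QTT

open Polynomial

theorem two_mul_chebNode_sub_one (N : ℕ) (α : Fin (N + 1)) :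
    2 * chebNode N α - 1 = Real.cos (Real.pi * (α : ℕ) / N) := by
  unfold chebNode; ring

theorem chebNode_mem (N : ℕ) (α : Fin (N + 1)) : chebNode N α ∈ Set.Icc (0 : ℝ) 1 := by
  have h := two_mul_chebNode_sub_one N α
  constructor
  · linarith [Real.neg_one_le_cos (Real.pi * (α : ℕ) / N)]
  · linarith [Real.cos_le_one (Real.pi * (α : ℕ) / N)]

theorem chebNode_injective {N : ℕ} (hN : 1 ≤ N) : Function.Injective (chebNode N) := by
  have hN0 : (0 : ℝ) < N := by exact_mod_cast hN
  have hmem : ∀ α : Fin (N + 1), Real.pi * (α : ℕ) / N ∈ Set.Icc 0 Real.pi := by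
    intro α
    have : ((α : ℕ) : ℝ) ≤ N := by exact_mod_cast Nat.lt_succ_iff.1 α.2
    refine ⟨by positivity, ?_⟩
    rw [div_le_iff₀ hN0]
    gcongr
  intro α β h
  have h1 : Real.cos (Real.pi * (α : ℕ) / N) = Real.cos (Real.pi * (β : ℕ) / N) := by
    rw [← two_mul_chebNode_sub_one, ← two_mul_chebNode_sub_one, h]
  have h2 := Real.injOn_cos (hmem α) (hmem β) h1
  rw [div_left_inj' hN0.ne', mul_right_inj' Real.pi_ne_zero] at h2
  exact Fin.ext (by exact_mod_cast h2)

theorem sum_eval_chebNode_mul_chebCardinal {N : ℕ} (hN : 1 ≤ N) {p : ℝ[X]}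
    (hp : p.natDegree ≤ N) (v : ℝ) :
    ∑ α, p.eval (chebNode N α) * (chebCardinal N α).eval v = p.eval v := by
  have hdeg : p.degree < (Finset.univ : Finset (Fin (N + 1))).card := by
    rw [Finset.card_univ, Fintype.card_fin]
    exact lt_of_le_of_lt (degree_le_of_natDegree_le hp) (by exact_mod_cast Nat.lt_succ_self N)
  conv_rhs => rw [Lagrange.eq_interpolate (chebNode_injective hN).injOn hdeg]
  simp [Lagrange.interpolate_apply, eval_finsetSum, chebCardinal]

/-- Aliasing: on the Chebyshev–Lobatto grid every Chebyshev polynomial coincides with one of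
degree at most `N`, because `cos (n π α / N)` only depends on `± n` modulo `2 N`. -/
theorem exists_chebyshev_alias {N : ℕ} (hN : 1 ≤ N) (n : ℤ) :
    ∃ j : ℤ, j.natAbs ≤ N ∧ ∀ α : Fin (N + 1),
      (Chebyshev.T ℝ n).eval (2 * chebNode N α - 1) =
        (Chebyshev.T ℝ j).eval (2 * chebNode N α - 1) := by
  have hN0 : (N : ℝ) ≠ 0 := by positivity
  have hN' : (0 : ℤ) < 2 * N := by omega
  have h0 := Int.emod_nonneg n hN'.ne'
  have h1 := Int.emod_lt_of_pos n hN'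
  have periodic : ∀ q : ℤ, ∀ α : Fin (N + 1),
      (Chebyshev.T ℝ n).eval (2 * chebNode N α - 1) =
        (Chebyshev.T ℝ (n - 2 * N * q)).eval (2 * chebNode N α - 1) := by
    intro q α
    rw [two_mul_chebNode_sub_one, Chebyshev.T_real_cos, Chebyshev.T_real_cos,
      ← Real.cos_sub_int_mul_two_pi _ (q * (α : ℕ))]
    congr 1
    push_cast
    field_simp
  have hdiv : n % (2 * N) = n - 2 * N * (n / (2 * N)) := Int.emod_def _ _
  by_cases h : n % (2 * N) ≤ N
  · exact ⟨n % (2 * N), by omega, fun α => by rw [hdiv]; exact periodic _ α⟩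
  · refine ⟨n % (2 * N) - 2 * N, by omega, fun α => ?_⟩
    rw [hdiv, sub_sub, show (2 * N * (n / (2 * N)) + 2 * N : ℤ) = 2 * N * (n / (2 * N) + 1) by ring]
    exact periodic _ α

theorem natDegree_chebyshev_comp_le (n : ℤ) :
    ((Chebyshev.T ℝ n).comp (2 * X - 1)).natDegree ≤ n.natAbs := by
  refine natDegree_comp_le.trans ?_
  rw [Chebyshev.natDegree_T]
  have : (2 * X - 1 : ℝ[X]).natDegree ≤ 1 := by
    compute_degree
  simpa using Nat.mul_le_mul_left n.natAbs this

/-- The signed error at `v` of interpolating `g` on the Chebyshev–Lobatto grid of `[0, 1]`. -/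
noncomputable def signedError (N : ℕ) (g : ℝ → ℝ) (v : ℝ) : ℝ :=
  g v - ∑ α : Fin (N + 1), g (chebNode N α) * (chebCardinal N α).eval v

theorem signedError_chebyshev_eq_zero {N : ℕ} (hN : 1 ≤ N) {n : ℤ} (hn : n.natAbs ≤ N) (v : ℝ) :
    signedError N (fun x => (Chebyshev.T ℝ n).eval (2 * x - 1)) v = 0 := by
  have := sum_eval_chebNode_mul_chebCardinal hN ((natDegree_chebyshev_comp_le n).trans hn) v
  simp only [eval_comp, eval_sub, eval_mul, eval_ofNat, eval_X, eval_one] at this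
  rw [signedError, this, sub_self]

theorem abs_signedError_chebyshev_le {N : ℕ} (hN : 1 ≤ N) (n : ℤ) {v : ℝ}
    (hv : v ∈ Set.Icc (0 : ℝ) 1) :
    |signedError N (fun x => (Chebyshev.T ℝ n).eval (2 * x - 1)) v| ≤ 2 := by
  obtain ⟨j, hj, hnj⟩ := exists_chebyshev_alias hN n
  -- the interpolant of `T n` is `T j`
  have h := signedError_chebyshev_eq_zero hN hj v
  simp only [signedError, ← hnj] at h
  have hv1 : |2 * v - 1| ≤ 1 := abs_le.2 ⟨by linarith [hv.1], by linarith [hv.2]⟩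
  have h1 := Chebyshev.abs_eval_T_real_le_one n hv1
  have h2 := Chebyshev.abs_eval_T_real_le_one j hv1
  rw [signedError, ← sub_eq_zero.1 h]
  exact (abs_sub _ _).trans (by linarith)

/-- A two-sided geometric tail. -/
theorem hasSum_geometric_natAbs_tail {r : ℝ} (h0 : 0 ≤ r) (h1 : r < 1) (N : ℕ) :
    HasSum (fun n : ℤ => if n.natAbs ≤ N then 0 else r ^ n.natAbs)
      (2 * (r ^ (N + 1) / (1 - r))) := by
  have hg := (hasSum_geometric_of_lt_one h0 h1).mul_left (r ^ (N + 1))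
  have hnat : HasSum (fun n : ℕ => if n ≤ N then 0 else r ^ n) (r ^ (N + 1) * (1 - r)⁻¹) := by
    have hz : ∑ i ∈ Finset.range (N + 1), (if i ≤ N then 0 else r ^ i) = 0 :=
      Finset.sum_eq_zero fun i hi => if_pos (Nat.lt_succ_iff.1 (Finset.mem_range.1 hi))
    have h := hasSum_nat_add_iff (f := fun n => if n ≤ N then 0 else r ^ n)
      (g := r ^ (N + 1) * (1 - r)⁻¹) (N + 1)
    rw [hz, add_zero] at h
    refine h.1 ?_
    refine hg.congr_fun fun n => ?_
    rw [if_neg (by omega), pow_add, mul_comm]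
  have hneg : HasSum (fun n : ℕ => if n + 1 ≤ N then 0 else r ^ (n + 1))
      (r ^ (N + 1) * (1 - r)⁻¹) := by
    have := (hasSum_nat_add_iff (f := fun n : ℕ => if n ≤ N then 0 else r ^ n)
      (g := r ^ (N + 1) * (1 - r)⁻¹) 1).2 (by simpa using hnat)
    exact this
  rw [show 2 * (r ^ (N + 1) / (1 - r)) = r ^ (N + 1) * (1 - r)⁻¹ + r ^ (N + 1) * (1 - r)⁻¹ by ring]
  refine HasSum.of_nat_of_neg_add_one (by simpa using hnat) ?_
  convert hneg using 2 with n
  have : (-((n : ℤ) + 1)).natAbs = n + 1 := by omega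
  rw [this]

/-- The error bound for Chebyshev–Lobatto interpolation of a function analytic on a Bernstein
ellipse: only the terms of degree above `N` of its Chebyshev series contribute, each with at most
twice its coefficient. -/
theorem abs_signedError_le {ρ B : ℝ} (hρ : 1 < ρ) {g : ℝ → ℝ}
    (hg : HasBoundedAnalyticExtension ρ B g) {N : ℕ} (hN : 1 ≤ N) {v : ℝ}
    (hv : v ∈ Set.Icc (0 : ℝ) 1) :
    |signedError N g v| ≤ 4 * B * ρ ^ (-(N : ℤ)) / (ρ - 1) := by
  have hρ0 : 0 < ρ := by linarith
  have hρi : ρ⁻¹ < 1 := inv_lt_one_of_one_lt₀ hρ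
  obtain ⟨c, hc, hs⟩ := exists_hasSum_chebyshev hρ hg
  let e : ℤ → ℝ := fun n => signedError N (fun x => (Chebyshev.T ℝ n).eval (2 * x - 1)) v
  have herr : HasSum (fun n => c n * e n) (signedError N g v) := by
    have h := (hs v hv).sub (hasSum_sum (s := Finset.univ) fun α _ =>
      (hs _ (chebNode_mem N α)).mul_right ((chebCardinal N α).eval v))
    refine h.congr_fun fun n => ?_
    simp only [e, signedError, mul_sub, Finset.mul_sum, mul_assoc]
  have htail := (hasSum_geometric_natAbs_tail (inv_nonneg.2 hρ0.le) hρi N).mul_left (2 * B)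
  have hterm : ∀ n, ‖c n * e n‖ ≤ 2 * B * (if n.natAbs ≤ N then 0 else ρ⁻¹ ^ n.natAbs) := by
    intro n
    split_ifs with h
    · have : e n = 0 := signedError_chebyshev_eq_zero hN h v
      simp [this]
    · rw [norm_mul, Real.norm_eq_abs, Real.norm_eq_abs]
      calc |c n| * |e n| ≤ B * ρ⁻¹ ^ n.natAbs * 2 :=
            mul_le_mul (hc n) (abs_signedError_chebyshev_le hN n hv) (abs_nonneg _)
              ((abs_nonneg _).trans (hc n))
        _ = _ := by ring
  have hle := tsum_of_norm_bounded htail hterm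
  rw [herr.tsum_eq, Real.norm_eq_abs] at hle
  refine hle.trans_eq ?_
  have hρ1 : ρ - 1 ≠ 0 := by linarith
  have hρ2 : 1 - ρ⁻¹ ≠ 0 := by linarith
  rw [zpow_neg, zpow_natCast, inv_pow, pow_succ]
  field_simp
  ring

theorem pointwiseError_le {ρ B : ℝ} (hρ : 1 < ρ) {f : ℝ → ℝ}
    (hf : HasBoundedAnalyticExtension ρ B f) (m : ℕ) {N : ℕ} (hN : 1 ≤ N) {u v : ℝ}
    (hu : u ∈ Set.Icc (0 : ℝ) (1 - 1 / 2 ^ m)) (hv : v ∈ Set.Icc (0 : ℝ) 1) :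
    pointwiseError m N f u v ≤ 4 * B * levelRho ρ m ^ (-(N : ℤ)) / (levelRho ρ m - 1) :=
  abs_signedError_le (one_lt_levelRho hρ m) (hf.rescale hρ m hu) hN hv

theorem HasBoundedAnalyticExtension.continuousOn {ρ B : ℝ} (hρ : 1 < ρ) {f : ℝ → ℝ}
    (hf : HasBoundedAnalyticExtension ρ B f) : ContinuousOn f (Set.Icc 0 1) := by
  obtain ⟨F, hF, hfF, -⟩ := hf
  have h : ContinuousOn (fun x : ℝ => (F x).re) (Set.Icc 0 1) := by
    refine Complex.continuous_re.comp_continuousOn ?_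
    exact ContinuousOn.comp (g := F) hF.continuousOn Complex.continuous_ofReal.continuousOn
      fun x hx => ofReal_mem_shiftedEllipse hρ hx
  exact h.congr fun x hx => by simp [hfF x hx]

theorem add_div_two_pow_mem {m : ℕ} {u v : ℝ} (hu : u ∈ Set.Icc (0 : ℝ) (1 - 1 / 2 ^ m))
    (hv : v ∈ Set.Icc (0 : ℝ) 1) : u + v / 2 ^ m ∈ Set.Icc (0 : ℝ) 1 := by
  have h1 : v / 2 ^ m ≤ 1 / 2 ^ m := by gcongr; exact hv.2
  have h0 : 0 ≤ v / 2 ^ m := div_nonneg hv.1 (by positivity)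
  exact ⟨by linarith [hu.1], by linarith [hu.2]⟩

theorem isGreatest_interpError {ρ B : ℝ} (hρ : 1 < ρ) {f : ℝ → ℝ}
    (hf : HasBoundedAnalyticExtension ρ B f) (m N : ℕ) :
    IsGreatest (errorValues m N f) (interpError m N f) := by
  have himage : errorValues m N f = (fun p : ℝ × ℝ => pointwiseError m N f p.1 p.2) ''
      (Set.Icc (0 : ℝ) (1 - 1 / 2 ^ m) ×ˢ Set.Icc (0 : ℝ) 1) := by
    ext e
    constructor
    · rintro ⟨u, hu, v, hv, rfl⟩
      exact ⟨(u, v), ⟨hu, hv⟩, rfl⟩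
    · rintro ⟨⟨u, v⟩, ⟨hu, hv⟩, rfl⟩
      exact ⟨u, hu, v, hv, rfl⟩
  have hcf := hf.continuousOn hρ
  have hcont : ContinuousOn (fun p : ℝ × ℝ => pointwiseError m N f p.1 p.2)
      (Set.Icc (0 : ℝ) (1 - 1 / 2 ^ m) ×ˢ Set.Icc (0 : ℝ) 1) := by
    unfold pointwiseError
    refine (ContinuousOn.sub ?_ (continuousOn_finsetSum _ fun α _ => ContinuousOn.mul ?_ ?_)).abs
    · exact hcf.comp (by fun_prop) fun p hp => add_div_two_pow_mem hp.1 hp.2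
    · exact hcf.comp (by fun_prop) fun p hp => add_div_two_pow_mem hp.1 (chebNode_mem N α)
    · exact ((chebCardinal N α).continuous.comp continuous_snd).continuousOn
  have hne : (Set.Icc (0 : ℝ) (1 - 1 / 2 ^ m) ×ˢ Set.Icc (0 : ℝ) 1).Nonempty := by
    refine ⟨(0, 0), ⟨le_rfl, ?_⟩, le_rfl, zero_le_one⟩
    have : (1 : ℝ) / 2 ^ m ≤ 1 := div_le_one_of_le₀ (one_le_pow₀ one_le_two) (by positivity)
    change (0 : ℝ) ≤ 1 - 1 / 2 ^ m
    linarith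
  have hcomp : IsCompact (errorValues m N f) := by
    rw [himage]
    exact (isCompact_Icc.prod isCompact_Icc).image_of_continuousOn hcont
  exact hcomp.isGreatest_sSup (himage ▸ hne.image _)

end QTT

/-! ### Ranks of the quantized tensor -/

namespace QTT

/-- Splitting the bits after position `m` writes the dyadic point as `u + 2⁻ᵐ v`. -/
theorem dyadicPoint_eq_add {K m : ℕ} (hm : m ≤ K) (σ : Fin K → Fin 2) :
    dyadicPoint σ = dyadicPoint (leftBits hm σ) + dyadicPoint (rightBits hm σ) / 2 ^ m := by
  obtain ⟨n, rfl⟩ := Nat.exists_eq_add_of_le hm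
  have h : ∀ (k : ℕ) (e : k = n) (τ : Fin k → Fin 2),
      dyadicPoint τ = ∑ i : Fin n, ((τ (Fin.cast e.symm i) : ℕ) : ℝ) / 2 ^ ((i : ℕ) + 1) := by
    rintro k rfl τ
    rfl
  rw [h (m + n - m) (Nat.add_sub_cancel_left m n) (rightBits hm σ), dyadicPoint, Fin.sum_univ_add,
    Finset.sum_div]
  congr 1
  refine Finset.sum_congr rfl fun i _ => ?_
  rw [div_div]
  congr 1
  rw [Fin.val_natAdd, ← pow_add]
  congr 1
  omega

theorem dyadicPoint_mem {K : ℕ} (σ : Fin K → Fin 2) :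
    dyadicPoint σ ∈ Set.Icc (0 : ℝ) (1 - 1 / 2 ^ K) := by
  constructor
  · exact Finset.sum_nonneg fun k _ => by positivity
  · have hgeom : ∑ k : Fin K, (1 : ℝ) / 2 ^ ((k : ℕ) + 1) = 1 - 1 / 2 ^ K := by
      rw [Fin.sum_univ_eq_sum_range fun k => (1 : ℝ) / 2 ^ (k + 1)]
      induction K with
      | zero => simp
      | succ K ih => rw [Finset.sum_range_succ, ih fun k => 0]; field_simp; ring
    rw [← hgeom]
    refine Finset.sum_le_sum fun k _ => ?_
    gcongr
    exact_mod_cast Nat.lt_succ_iff.1 (σ k).2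

/-- Interpolating in the trailing bits, with `u` given by the leading bits, separates the two
groups of bits into `N + 1` terms. -/
theorem supRank_le_of_pointwiseError_le {K m : ℕ} (hm : m ≤ K) {ε : ℝ} (hε : 0 ≤ ε) {f : ℝ → ℝ}
    {N : ℕ} (h : ∀ u ∈ Set.Icc (0 : ℝ) (1 - 1 / 2 ^ m), ∀ v ∈ Set.Icc (0 : ℝ) 1,
      pointwiseError m N f u v ≤ ε) :
    supRank hm ε (quantizedTensor K f) ≤ N + 1 := by
  refine Nat.sInf_le ⟨fun α τ => f (dyadicPoint τ + chebNode N α / 2 ^ m),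
    fun α ω => (chebCardinal N α).eval (dyadicPoint ω), ?_⟩
  refine (pi_norm_le_iff_of_nonneg hε).2 fun σ => ?_
  have hv := dyadicPoint_mem (rightBits hm σ)
  have h1 := h _ (dyadicPoint_mem (leftBits hm σ)) (dyadicPoint (rightBits hm σ))
    ⟨hv.1, hv.2.trans (sub_le_self _ (by positivity))⟩
  rw [pointwiseError, ← dyadicPoint_eq_add hm σ] at h1
  exact h1

theorem supRank_le {ρ B : ℝ} (hρ : 1 < ρ) {f : ℝ → ℝ}
    (hf : HasBoundedAnalyticExtension ρ B f) {K m : ℕ} (hm : m ≤ K) {ε : ℝ} (hε : 0 ≤ ε)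
    {N : ℕ} (hN : 1 ≤ N)
    (h : 4 * B * levelRho ρ m ^ (-(N : ℤ)) / (levelRho ρ m - 1) ≤ ε) :
    supRank hm ε (quantizedTensor K f) ≤ N + 1 :=
  supRank_le_of_pointwiseError_le hm hε fun _ hu _ hv => (pointwiseError_le hρ hf m hN hu hv).trans h

/-- Solving the error bound for the degree `N`. -/
theorem error_bound_le_of_logb_le {R B ε : ℝ} (hR : 1 < R) (hB : 0 < B) (hε : 0 < ε) {N : ℕ}
    (h : Real.logb R (1 / ε) - Real.logb R (R - 1) + Real.logb R (4 * B) ≤ N) :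
    4 * B * R ^ (-(N : ℤ)) / (R - 1) ≤ ε := by
  have hR1 : 0 < R - 1 := by linarith
  rw [← Real.logb_div (by positivity) hR1.ne', ← Real.logb_mul (by positivity) (by positivity),
    Real.logb_le_iff_le_rpow hR (by positivity), Real.rpow_natCast] at h
  have hRN : 0 < R ^ N := by positivity
  rw [zpow_neg, zpow_natCast, div_le_iff₀ hR1, ← div_eq_mul_inv, div_le_iff₀ hRN]
  calc 4 * B = (1 / ε / (R - 1) * (4 * B)) * (ε * (R - 1)) := by field_simp
    _ ≤ R ^ N * (ε * (R - 1)) := by gcongr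
    _ = _ := by ring

/-- Since `levelRho ρ m` grows like `2 ^ m`, it exceeds every smaller exponential, and the constants
in the error bound are absorbed. -/
theorem exists_level_bound {ρ : ℝ} (hρ : 1 < ρ) (B : ℝ) {δ : ℝ} (hδ : 0 < δ) :
    ∃ M : ℕ, 1 ≤ M ∧ ∀ m : ℕ, M ≤ m → 4 * B ≤ levelRho ρ m - 1 ∧
      (2 : ℝ) ^ ((m : ℝ) / (1 + δ)) ≤ levelRho ρ m := by
  have hκ : 0 < (ρ - 1) ^ 2 / ρ := div_pos (pow_pos (by linarith) 2) (by linarith)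
  set κ := (ρ - 1) ^ 2 / ρ
  have hpow : Filter.Tendsto (fun m : ℕ => (2 : ℝ) ^ m * κ) Filter.atTop Filter.atTop :=
    (tendsto_pow_atTop_atTop_of_one_lt one_lt_two).atTop_mul_const hκ
  have hexp : Filter.Tendsto (fun m : ℕ => (m : ℝ) * (δ / (1 + δ)))
      Filter.atTop Filter.atTop :=
    tendsto_natCast_atTop_atTop.atTop_mul_const (by positivity)
  have hev := ((hpow.eventually_ge_atTop (4 * B + 1)).and
    (hexp.eventually_ge_atTop (Real.logb 2 κ⁻¹))).and (Filter.eventually_ge_atTop 1)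
  obtain ⟨M, hM⟩ := Filter.eventually_atTop.1 hev
  refine ⟨M, (hM M le_rfl).2, fun m hm => ?_⟩
  obtain ⟨⟨h1, h2⟩, -⟩ := hM m hm
  have hle : (2 : ℝ) ^ m * κ ≤ levelRho ρ m := le_max_right _ _
  refine ⟨by linarith, le_trans ?_ hle⟩
  rw [Real.logb_le_iff_le_rpow one_lt_two (inv_pos.2 hκ)] at h2
  have hsplit : (2 : ℝ) ^ m =
      (2 : ℝ) ^ ((m : ℝ) / (1 + δ)) * (2 : ℝ) ^ ((m : ℝ) * (δ / (1 + δ))) := by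
    rw [← Real.rpow_add two_pos, ← Real.rpow_natCast]
    congr 1
    field_simp
  calc (2 : ℝ) ^ ((m : ℝ) / (1 + δ)) = 2 ^ ((m : ℝ) / (1 + δ)) * κ⁻¹ * κ := by
        field_simp
    _ ≤ 2 ^ ((m : ℝ) / (1 + δ)) * 2 ^ ((m : ℝ) * (δ / (1 + δ))) * κ := by gcongr
    _ = _ := by rw [hsplit]

end QTT

theorem mainTheorem5 (ρ B : ℝ) (hρ : 1 < ρ) (hB : 0 ≤ B) :
    -- the interpolation error: the maximum is attained, and it obeys the bound
    (∀ f : ℝ → ℝ, QTT.HasBoundedAnalyticExtension ρ B f → ∀ m N : ℕ, 1 ≤ N →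
      IsGreatest (QTT.errorValues m N f) (QTT.interpError m N f) ∧
      QTT.interpError m N f ≤
        4 * B * QTT.levelRho ρ m ^ (-(N : ℤ)) / (QTT.levelRho ρ m - 1)) ∧
    -- the rank bound (for `B = 0` the logarithm of `4 * B` is read as `-∞`)
    (∀ f : ℝ → ℝ, QTT.HasBoundedAnalyticExtension ρ B f →
      ∀ (m K : ℕ) (hm : m < K) (ε : ℝ), 0 < ε →
      (0 < B → (QTT.supRank hm.le ε (QTT.quantizedTensor K f) : ℤ) ≤
        1 + max 1 ⌈Real.logb (QTT.levelRho ρ m) (1 / ε)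
          - Real.logb (QTT.levelRho ρ m) (QTT.levelRho ρ m - 1)
          + Real.logb (QTT.levelRho ρ m) (4 * B)⌉) ∧
      (B = 0 → (QTT.supRank hm.le ε (QTT.quantizedTensor K f) : ℤ) ≤ 1 + 1)) ∧
    -- the decay of the ranks with the level, uniformly in `f`, `K` and `ε`
    (∀ δ : ℝ, 0 < δ → ∃ M : ℕ, ∀ m : ℕ, M ≤ m →
      ∀ f : ℝ → ℝ, QTT.HasBoundedAnalyticExtension ρ B f →
      ∀ (K : ℕ) (hm : m < K) (ε : ℝ), 0 < ε → ε < 1 →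
      (QTT.supRank hm.le ε (QTT.quantizedTensor K f) : ℤ) ≤
        1 + ⌈(1 + δ) * (Real.logb 2 (1 / ε) / m)⌉) := by
  refine ⟨fun f hf m N hN => ?_, fun f hf m K hm ε hε => ⟨fun hB0 => ?_, fun hB0 => ?_⟩,
    fun δ hδ => ?_⟩
  · have hmax := QTT.isGreatest_interpError hρ hf m N
    refine ⟨hmax, ?_⟩
    obtain ⟨u, hu, v, hv, huv⟩ := hmax.1
    rw [huv]
    exact QTT.pointwiseError_le hρ hf m hN hu hv
  · set x := Real.logb (QTT.levelRho ρ m) (1 / ε)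
      - Real.logb (QTT.levelRho ρ m) (QTT.levelRho ρ m - 1)
      + Real.logb (QTT.levelRho ρ m) (4 * B)
    obtain ⟨N, hN⟩ := Int.eq_ofNat_of_zero_le (zero_le_one.trans (le_max_left 1 ⌈x⌉))
    have hN1 : 1 ≤ N := by have := le_max_left 1 ⌈x⌉; omega
    have hxN : x ≤ N := by
      have h1 : ⌈x⌉ ≤ (N : ℤ) := hN ▸ le_max_right 1 ⌈x⌉
      exact_mod_cast Int.ceil_le.1 h1
    have := QTT.supRank_le hρ hf hm.le hε.le hN1
      (QTT.error_bound_le_of_logb_le (QTT.one_lt_levelRho hρ m) hB0 hε hxN)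
    rw [hN]
    omega
  · have := QTT.supRank_le hρ hf hm.le hε.le (le_refl 1) (by simp [hB0, hε.le])
    omega
  · obtain ⟨M, hM1, hM⟩ := QTT.exists_level_bound hρ B hδ
    refine ⟨M, fun m hmM f hf K hm ε hε hε1 => ?_⟩
    obtain ⟨h1, h2⟩ := hM m hmM
    have hm0 : (0 : ℝ) < m := by exact_mod_cast hM1.trans hmM
    have hR := QTT.one_lt_levelRho hρ m
    set R := QTT.levelRho ρ m
    have hlog : 0 < Real.logb 2 (1 / ε) :=
      Real.logb_pos one_lt_two ((one_lt_div hε).2 hε1)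
    set x := (1 + δ) * (Real.logb 2 (1 / ε) / m) with hx
    have hx0 : 0 < x := by positivity
    obtain ⟨N, hN⟩ := Int.eq_ofNat_of_zero_le (Int.ceil_pos.2 hx0).le
    have hN1 : 1 ≤ N := by have := Int.ceil_pos.2 hx0; omega
    have hxN : x ≤ N := by exact_mod_cast Int.ceil_le.1 hN.le
    have hpow : 1 / ε ≤ R ^ N := by
      calc 1 / ε = (2 : ℝ) ^ Real.logb 2 (1 / ε) :=
            (Real.rpow_logb two_pos (by norm_num) (by positivity)).symm
        _ = (2 : ℝ) ^ ((m : ℝ) / (1 + δ) * x) := by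
            rw [hx]; congr 1; field_simp
        _ ≤ (2 : ℝ) ^ ((m : ℝ) / (1 + δ) * N) := by
            gcongr
            exact one_le_two
        _ = ((2 : ℝ) ^ ((m : ℝ) / (1 + δ))) ^ N := by
            rw [Real.rpow_mul zero_le_two, Real.rpow_natCast]
        _ ≤ R ^ N := by gcongr
    have hbound : 4 * B * R ^ (-(N : ℤ)) / (R - 1) ≤ ε := by
      have hinv : R ^ (-(N : ℤ)) ≤ ε := by
        rw [zpow_neg, zpow_natCast]
        exact inv_le_of_inv_le₀ hε (by simpa using hpow)
      rw [div_le_iff₀ (by linarith), mul_comm ε]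
      exact mul_le_mul h1 hinv (by positivity) (by linarith)
    have := QTT.supRank_le hρ hf hm.le hε.le hN1 hbound
    rw [hN]
    omega
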